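/- Let $n\ge 0$, let $B=\{x\in\mathbb{R}^n:|x|\le 1\}$, and let $\omega_k=\pi^{k/2}/\Gamma(\tfrac k2+1)$ be the volume of the $k$-dimensional Euclidean unit ball. For a nonempty bounded convex set $K\subseteq\mathbb{R}^n$ the volume of $K+\lambda B$ is, by the Steiner formula, a polynomial in $\lambda$ of degree at most $n$: there are unique real numbers $W_0(K),\dots,W_n(K)$ with $$\mathrm{vol}(K+\lambda B)=\sum_{i=0}^n\binom ni W_i(K)\,\lambda^i\qquad\text{for all }\lambda\ge 0 .$$ The intrinsic volumes of $K$ are $$V_i(K)=\frac{\binom ni}{\omega_{n-i}}\,W_{n-i}(K),\qquad 0\le i\le n,$$ and $V_i(K)=0$ for $i>n$. **Proposition.** Let $K\subseteq\mathbb{R}^n$ be a nonempty bounded convex set and let $Z\sim N(0,I_n)$ be a standard Gaussian random vector. Then $K$ satisfies the Steiner formula above, the random variable $\sup_{y\in\sqrt{2\pi}\,K}\langle Z,y\rangle$ is integrable, and $$V_1(K)=\mathbb{E}\Big[\sup_{y\in\sqrt{2\pi}\,K}\langle Z,y\rangle\Big].$$ -/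

import Mathlib

open MeasureTheory ProbabilityTheory
open scoped Pointwise

/-- `ω_k = π^(k/2) / Γ(k/2 + 1)`, the volume of the `k`-dimensional Euclidean unit ball. -/
noncomputable def unitBallVolume (k : ℕ) : ℝ :=
  Real.pi ^ ((k : ℝ) / 2) / Real.Gamma ((k : ℝ) / 2 + 1)

/-- The outer parallel set `K + t B`, where `B` is the closed Euclidean unit ball. -/
def parallelSet {n : ℕ} (K : Set (EuclideanSpace ℝ (Fin n))) (t : ℝ) :
    Set (EuclideanSpace ℝ (Fin n)) :=
  K + t • Metric.closedBall (0 : EuclideanSpace ℝ (Fin n)) 1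

/-- `p` is a polynomial of degree at most `n` such that, for every `t ≥ 0`, the volume of
`K + t B` is finite and equal to `p(t)`. -/
def IsSteinerPolynomial {n : ℕ} (K : Set (EuclideanSpace ℝ (Fin n))) (p : Polynomial ℝ) : Prop :=
  p.natDegree ≤ n ∧ ∀ t : ℝ, 0 ≤ t →
    volume (parallelSet K t) ≠ ⊤ ∧ volume.real (parallelSet K t) = p.eval t

/-- There is at most one Steiner polynomial. -/
theorem IsSteinerPolynomial.unique {n : ℕ} {K : Set (EuclideanSpace ℝ (Fin n))}
    {p q : Polynomial ℝ} (hp : IsSteinerPolynomial K p) (hq : IsSteinerPolynomial K q) :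
    p = q := by
  refine Polynomial.eq_of_infinite_eval_eq p q ((Set.Ici_infinite (0 : ℝ)).mono ?_)
  intro t ht
  exact ((hp.2 t ht).2).symm.trans (hq.2 t ht).2

open Classical in
/-- The polynomial `t ↦ vol (K + t B)`, `t ≥ 0` (with value `0` if there is no such
polynomial of degree at most `n`). -/
noncomputable def steinerPolynomial {n : ℕ} (K : Set (EuclideanSpace ℝ (Fin n))) :
    Polynomial ℝ :=
  if h : ∃ p : Polynomial ℝ, IsSteinerPolynomial K p then h.choose else 0

/-- The quermassintegrals `W_i(K)`, that is, the numbers with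
`vol (K + t B) = ∑ i ∈ {0, …, n}, (n choose i) W_i(K) t ^ i` for all `t ≥ 0`. -/
noncomputable def quermassintegral {n : ℕ} (K : Set (EuclideanSpace ℝ (Fin n))) (i : ℕ) : ℝ :=
  (steinerPolynomial K).coeff i / (n.choose i : ℝ)

/-- The intrinsic volumes `V_i(K) = (n choose i) / ω_(n-i) * W_(n-i)(K)` for `0 ≤ i ≤ n`.
For `i > n` the binomial coefficient vanishes, which gives the usual convention `V_i(K) = 0`. -/
noncomputable def intrinsicVolume {n : ℕ} (i : ℕ) (K : Set (EuclideanSpace ℝ (Fin n))) : ℝ :=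
  (n.choose i : ℝ) / unitBallVolume (n - i) * quermassintegral K (n - i)

/-! Two facts are combined: a Jacobian proof of Steiner's formula, and a Gaussian integral that
encodes all intrinsic volumes at once.

Steiner: let π be the nearest-point projection onto the closure of `K`. The map x ↦ x + s(x − πx)
carries the r-parallel body bijectively onto the (1+s)r-parallel body, and its Jacobian det(I + s(I
− Dπ)) is positive and polynomial in s of degree at most n. Integrating, the volume is polynomial in
s (`exists_isSteinerPolynomial`).

Gaussian: write d for the distance to `K` and σ = √(2π). The layer-cake formula and Steiner give s^n
∫ exp(−π s² d²) = Q(s) = ∑ V_i(K) s^i (`IsSteinerPolynomial.integral_exp_neg_pi_mul_infDist_sq`).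
Rescaling turns the left side into E exp((|Z|² − dist(Z, σsK)²)/2). With h the support function of
`K`, the exponent is σs h(Z) + O(s²), so dominated convergence gives Q'(0) = σ E h(Z), while Q'(0) =
V_1(K). -/

/-! ### Metric projections onto convex sets -/

section MetricProjection

variable {E : Type*} [NormedAddCommGroup E] [InnerProductSpace ℝ E]

/-- `π` sends every point to a point of `C` satisfying the variational inequality
that characterizes the nearest point of a convex set. -/
def IsMetricProjection (C : Set E) (π : E → E) : Prop :=
  ∀ x, π x ∈ C ∧ ∀ w ∈ C, inner ℝ (x - π x) (w - π x) ≤ 0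

/-- The expansion `x ↦ x + s (x - π x)` away from the range of `π`. -/
def expansion (π : E → E) (s : ℝ) (x : E) : E := x + s • (x - π x)

theorem exists_isMetricProjection {C : Set E} (hne : C.Nonempty) (hC : IsComplete C)
    (hconv : Convex ℝ C) : ∃ π, IsMetricProjection C π := by
  choose π hπ hmin using exists_norm_eq_iInf_of_complete_convex hne hC hconv
  exact ⟨π, fun x => ⟨hπ x, (norm_eq_iInf_iff_real_inner_le_zero hconv (hπ x)).1 (hmin x)⟩⟩

namespace IsMetricProjection

variable {C : Set E} {π : E → E}

theorem norm_sub_le (hπ : IsMetricProjection C π) (x : E) {w : E} (hw : w ∈ C) :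
    ‖x - π x‖ ≤ ‖x - w‖ := by
  have h := (hπ x).2 w hw
  have e : x - w = (x - π x) - (w - π x) := by abel
  rw [← sq_le_sq₀ (norm_nonneg _) (norm_nonneg _), e, norm_sub_sq_real (x - π x)]
  nlinarith [sq_nonneg ‖w - π x‖]

theorem infDist_eq (hπ : IsMetricProjection C π) (x : E) : Metric.infDist x C = ‖x - π x‖ := by
  refine le_antisymm ?_ ?_
  · rw [← dist_eq_norm]
    exact Metric.infDist_le_dist_of_mem (hπ x).1
  · refine (Metric.le_infDist ⟨_, (hπ x).1⟩).2 fun w hw => ?_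
    rw [dist_eq_norm]
    exact hπ.norm_sub_le x hw

/-- Testing each variational inequality at the other point and adding gives ‖π x − p‖² ≤ 0. -/
theorem eq_of_inner_le_zero (hπ : IsMetricProjection C π) {x p : E} (hp : p ∈ C)
    (h : ∀ w ∈ C, inner ℝ (x - p) (w - p) ≤ 0) : π x = p := by
  have h1 := h _ (hπ x).1
  have h2 := (hπ x).2 p hp
  have e : inner ℝ (π x - p) (π x - p)
      = inner ℝ (x - p) (π x - p) + inner ℝ (x - π x) (p - π x) := by
    rw [← neg_sub (π x) p, inner_neg_right, ← sub_eq_add_neg, ← inner_sub_left]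
    congr 1
    abel
  rw [← sub_eq_zero, ← norm_eq_zero, ← sq_eq_zero_iff, ← real_inner_self_eq_norm_sq, e]
  refine le_antisymm (add_nonpos h1 h2) ?_
  rw [← e]
  exact real_inner_self_nonneg

/-- Firm nonexpansiveness: add the variational inequalities at x and y, each tested at the
projection of the other. -/
theorem norm_sub_sq_le_inner (hπ : IsMetricProjection C π) (x y : E) :
    ‖π x - π y‖ ^ 2 ≤ inner ℝ (x - y) (π x - π y) := by
  have h1 := (hπ x).2 _ (hπ y).1
  have h2 := (hπ y).2 _ (hπ x).1
  have e : inner ℝ (x - y) (π x - π y) - ‖π x - π y‖ ^ 2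
      = -(inner ℝ (x - π x) (π y - π x) + inner ℝ (y - π y) (π x - π y)) := by
    rw [← real_inner_self_eq_norm_sq, ← inner_sub_left, ← neg_sub (π x) (π y), inner_neg_right,
      neg_add, neg_neg, ← sub_eq_add_neg, ← inner_sub_left]
    congr 1
    abel
  linarith

theorem lipschitzWith (hπ : IsMetricProjection C π) : LipschitzWith 1 π := by
  refine LipschitzWith.of_dist_le_mul fun x y => ?_
  rw [dist_eq_norm, dist_eq_norm, NNReal.coe_one, one_mul]
  have h := (hπ.norm_sub_sq_le_inner x y).trans (real_inner_le_norm _ _)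
  rcases (norm_nonneg (π x - π y)).eq_or_lt with h0 | h0
  · rw [← h0]
    exact norm_nonneg _
  · rw [sq] at h
    exact le_of_mul_le_mul_right h h0

theorem lipschitzWith_expansion (hπ : IsMetricProjection C π) (s : ℝ) :
    LipschitzWith (1 + ‖s‖₊ * (1 + 1)) (expansion π s) :=
  LipschitzWith.id.add ((lipschitzWith_smul s).comp (LipschitzWith.id.sub hπ.lipschitzWith))

/-- Since π is nonexpansive, x ↦ x − π x is monotone, so the added displacement has nonnegative
inner product with x − y. -/
theorem norm_sub_le_norm_expansion_sub (hπ : IsMetricProjection C π) {s : ℝ} (hs : 0 ≤ s)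
    (x y : E) : ‖x - y‖ ≤ ‖expansion π s x - expansion π s y‖ := by
  have h1 := (hπ.norm_sub_sq_le_inner x y)
  have h2 : inner ℝ (x - y) (π x - π y) ≤ ‖x - y‖ ^ 2 := by
    have := hπ.lipschitzWith.dist_le_mul x y
    rw [dist_eq_norm, dist_eq_norm, NNReal.coe_one, one_mul] at this
    refine (real_inner_le_norm _ _).trans ?_
    nlinarith [norm_nonneg (x - y)]
  have e : expansion π s x - expansion π s y = (x - y) + s • ((x - y) - (π x - π y)) := by
    simp only [expansion, smul_sub]
    abel
  rw [← sq_le_sq₀ (norm_nonneg _) (norm_nonneg _), e, norm_add_sq_real, inner_smul_right,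
    inner_sub_right, real_inner_self_eq_norm_sq]
  nlinarith [sq_nonneg ‖s • ((x - y) - (π x - π y))‖, mul_nonneg hs (sub_nonneg.2 h2)]

theorem injective_expansion (hπ : IsMetricProjection C π) {s : ℝ} (hs : 0 ≤ s) :
    Function.Injective (expansion π s) := fun x y h => by
  simpa [h, sub_eq_zero] using hπ.norm_sub_le_norm_expansion_sub hs x y

theorem expansion_image (hπ : IsMetricProjection C π) {s : ℝ} (hs : 0 ≤ s) (r : ℝ) :
    expansion π s '' {x | Metric.infDist x C ≤ r} = {x | Metric.infDist x C ≤ (1 + s) * r} := by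
  have hs' : 0 < 1 + s := by linarith
  -- The whole normal ray from p through x projects to p, so the expansion multiplies distances to
  -- `C` by 1 + s along it.
  have key : ∀ x p : E, ∀ a : ℝ, 0 ≤ a → p ∈ C → (∀ w ∈ C, inner ℝ (x - p) (w - p) ≤ 0) →
      π (p + a • (x - p)) = p := fun x p a ha hp h => by
    refine hπ.eq_of_inner_le_zero hp fun w hw => ?_
    rw [add_sub_cancel_left, real_inner_smul_left]
    exact mul_nonpos_of_nonneg_of_nonpos ha (h w hw)
  have e1 : ∀ x, expansion π s x = π x + (1 + s) • (x - π x) := fun x => by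
    rw [expansion, add_smul, one_smul]
    abel
  ext z
  simp only [Set.mem_image, Set.mem_ofPred_eq]
  constructor
  · rintro ⟨x, hx, rfl⟩
    have := key x (π x) (1 + s) hs'.le (hπ x).1 (hπ x).2
    rw [e1, hπ.infDist_eq, this, add_sub_cancel_left, norm_smul, Real.norm_of_nonneg hs'.le]
    rw [hπ.infDist_eq] at hx
    gcongr
  · intro hz
    have h := key z (π z) (1 + s)⁻¹ (inv_nonneg.2 hs'.le) (hπ z).1 (hπ z).2
    refine ⟨π z + (1 + s)⁻¹ • (z - π z), ?_, ?_⟩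
    · rw [hπ.infDist_eq] at hz ⊢
      rw [h, add_sub_cancel_left, norm_smul, norm_inv, Real.norm_of_nonneg hs'.le]
      rwa [inv_mul_le_iff₀ hs']
    · rw [e1, h, add_sub_cancel_left, smul_smul, mul_inv_cancel₀ hs'.ne', one_smul]
      abel

end IsMetricProjection

end MetricProjection

/-! ### Parallel sets and sublevel sets of the distance -/

section ParallelSet

variable {n : ℕ} {K : Set (EuclideanSpace ℝ (Fin n))}

theorem parallelSet_subset_infDist_le {t : ℝ} (ht : 0 ≤ t) :
    parallelSet K t ⊆ {x | Metric.infDist x K ≤ t} := by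
  rintro _ ⟨y, hy, _, ⟨b, hb, rfl⟩, rfl⟩
  refine (Metric.infDist_le_dist_of_mem hy).trans ?_
  have hb' : ‖b‖ ≤ 1 := by simpa using hb
  simpa [dist_eq_norm, norm_smul, abs_of_nonneg ht] using mul_le_mul_of_nonneg_left hb' ht

/-- `K` need not be closed, so the distance may not be attained; a near-minimizer only yields
approximation by points of the parallel set. -/
theorem infDist_le_subset_closure_parallelSet (hne : K.Nonempty) {t : ℝ} (ht : 0 ≤ t) :
    {x | Metric.infDist x K ≤ t} ⊆ closure (parallelSet K t) := by
  intro x hx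
  refine Metric.mem_closure_iff.2 fun ε hε => ?_
  have hpos : 0 < t + ε := by linarith
  obtain ⟨y, hy, hxy⟩ := (Metric.infDist_lt_iff hne).1 (lt_of_le_of_lt hx (lt_add_of_pos_right t hε))
  refine ⟨y + t • ((t + ε)⁻¹ • (x - y)), Set.add_mem_add hy (Set.smul_mem_smul_set ?_), ?_⟩
  · rw [mem_closedBall_zero_iff, norm_smul, norm_inv, Real.norm_of_nonneg hpos.le,
      inv_mul_le_iff₀ hpos, mul_one, ← dist_eq_norm]
    exact hxy.le
  · have e : x - (y + t • ((t + ε)⁻¹ • (x - y))) = (ε / (t + ε)) • (x - y) := by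
      have : ε / (t + ε) = 1 - t * (t + ε)⁻¹ := by field_simp; ring
      rw [this, smul_smul, sub_smul, one_smul]
      abel
    rw [dist_eq_norm, e, norm_smul, Real.norm_of_nonneg (by positivity), div_mul_eq_mul_div,
      div_lt_iff₀ hpos, ← dist_eq_norm]
    gcongr

theorem convex_parallelSet (hconv : Convex ℝ K) (t : ℝ) : Convex ℝ (parallelSet K t) :=
  hconv.add ((convex_closedBall _ _).smul t)

/-- The two sets differ at most by boundary points of a convex set, which form a null set. -/
theorem volume_parallelSet (hconv : Convex ℝ K) (hne : K.Nonempty) {t : ℝ} (ht : 0 ≤ t) :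
    volume (parallelSet K t) = volume {x | Metric.infDist x K ≤ t} := by
  refine le_antisymm (measure_mono (parallelSet_subset_infDist_le ht)) ?_
  refine (measure_mono (infDist_le_subset_closure_parallelSet hne ht)).trans ?_
  have h : closure (parallelSet K t) ⊆ parallelSet K t ∪ frontier (parallelSet K t) := by
    rw [closure_eq_self_union_frontier]
  refine (measure_mono h).trans ((measure_union_le _ _).trans ?_)
  rw [(convex_parallelSet hconv t).addHaar_frontier volume, add_zero]

theorem volume_infDist_le_lt_top (hbdd : Bornology.IsBounded K) (hne : K.Nonempty) (t : ℝ) :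
    volume {x | Metric.infDist x K ≤ t} < ⊤ := by
  refine lt_of_le_of_lt (measure_mono fun x hx => ?_)
    (hbdd.thickening (δ := t + 1)).measure_lt_top
  rw [Metric.mem_thickening_iff_infDist_lt hne]
  exact lt_of_le_of_lt hx (lt_add_one t)

end ParallelSet

/-! ### Steiner's formula -/

section Steiner

/-- Haar measure and Hausdorff measure of full dimension have the same null sets, and the latter
grows by a bounded factor under Lipschitz maps. -/
theorem LipschitzWith.addHaar_image_eq_zero {E : Type*} [NormedAddCommGroup E] [NormedSpace ℝ E]
    [FiniteDimensional ℝ E] [MeasurableSpace E] [BorelSpace E] (μ : Measure E)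
    [μ.IsAddHaarMeasure] {C : NNReal} {f : E → E} (hf : LipschitzWith C f) {s : Set E}
    (hs : μ s = 0) : μ (f '' s) = 0 := by
  have h1 : (Measure.hausdorffMeasure (Module.finrank ℝ E : ℝ) : Measure E) s = 0 :=
    Measure.absolutelyContinuous_isAddHaarMeasure _ μ hs
  refine Measure.absolutelyContinuous_isAddHaarMeasure μ
    (Measure.hausdorffMeasure (Module.finrank ℝ E : ℝ)) (le_antisymm ?_ (zero_le))
  refine (hf.hausdorffMeasure_image_le (Nat.cast_nonneg _) s).trans ?_
  rw [h1, mul_zero]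

theorem exists_polynomial_eval_eq_det_add_smul {E : Type*} [NormedAddCommGroup E]
    [NormedSpace ℝ E] [FiniteDimensional ℝ E] (A B : E →L[ℝ] E) :
    ∃ p : Polynomial ℝ, p.natDegree ≤ Module.finrank ℝ E ∧ ∀ s : ℝ, p.eval s = (B + s • A).det := by
  let b := Module.finBasis ℝ E
  let MA := LinearMap.toMatrix b b (A : E →ₗ[ℝ] E)
  let MB := LinearMap.toMatrix b b (B : E →ₗ[ℝ] E)
  refine ⟨((Polynomial.X : Polynomial ℝ) • MA.map Polynomial.C + MB.map Polynomial.C).det, ?_, fun s => ?_⟩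
  · simpa using Polynomial.natDegree_det_X_add_C_le MA MB
  · rw [ContinuousLinearMap.det, ← LinearMap.det_toMatrix (A := ℝ) b, ← Polynomial.coe_evalRingHom,
      RingHom.map_det]
    congr 1
    ext i j
    simp [MA, MB]
    ring

/-- Recovering the polynomial linearly from its values at 0, …, n lets polynomiality pass through an
integral without integrating coefficients separately. -/
theorem Polynomial.eval_eq_sum_lagrange_basis_natCast {n : ℕ} {p : Polynomial ℝ}
    (hp : p.natDegree ≤ n) (s : ℝ) :
    p.eval s = ∑ j ∈ Finset.range (n + 1), p.eval (j : ℝ) *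
      (Lagrange.basis (Finset.range (n + 1)) (fun j : ℕ => (j : ℝ)) j).eval s := by
  have h := Lagrange.eq_interpolate (s := Finset.range (n + 1)) (v := fun j : ℕ => (j : ℝ))
    (f := p) (fun _ _ _ _ h => Nat.cast_injective h)
    (by
      rw [Finset.card_range]
      exact lt_of_le_of_lt Polynomial.degree_le_natDegree (by exact_mod_cast Nat.lt_succ_of_le hp))
  conv_lhs => rw [h, Lagrange.interpolate_apply]
  simp [Polynomial.eval_finsetSum]

variable {n : ℕ} {C : Set (EuclideanSpace ℝ (Fin n))}
  {π : EuclideanSpace ℝ (Fin n) → EuclideanSpace ℝ (Fin n)}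

namespace IsMetricProjection

theorem hasFDerivAt_expansion {x : EuclideanSpace ℝ (Fin n)} (hx : DifferentiableAt ℝ π x)
    (s : ℝ) : HasFDerivAt (expansion π s) (ContinuousLinearMap.id ℝ _ +
      s • (ContinuousLinearMap.id ℝ _ - fderiv ℝ π x)) x :=
  (hasFDerivAt_id x).add (((hasFDerivAt_id x).sub hx.hasFDerivAt).const_smul s)

/-- As ‖Dπ‖ ≤ 1, the operator is injective for every u ≥ 0. Its determinant is 1 at u = 0 and never
vanishes on [0, s], so it stays positive. -/
theorem det_fderiv_expansion_pos (hπ : IsMetricProjection C π) (x : EuclideanSpace ℝ (Fin n))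
    {s : ℝ} (hs : 0 ≤ s) :
    0 < (ContinuousLinearMap.id ℝ (EuclideanSpace ℝ (Fin n)) +
      s • (ContinuousLinearMap.id ℝ _ - fderiv ℝ π x)).det := by
  set I := ContinuousLinearMap.id ℝ (EuclideanSpace ℝ (Fin n))
  have hne : ∀ u : ℝ, 0 ≤ u → (I + u • (I - fderiv ℝ π x)).det ≠ 0 := by
    intro u hu
    have hinj : Function.Injective (I + u • (I - fderiv ℝ π x)) := by
      rw [injective_iff_map_eq_zero]
      intro v hv
      have h1 : ‖fderiv ℝ π x v‖ ≤ ‖v‖ := by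
        simpa using (fderiv ℝ π x).le_of_opNorm_le
          (norm_fderiv_le_of_lipschitz ℝ hπ.lipschitzWith) v
      have h2 : (1 + u) • v = u • fderiv ℝ π x v := by
        rw [add_smul, one_smul, ← sub_eq_zero, ← hv]
        simp [I, smul_sub, add_sub_assoc]
      have h3 := congrArg norm h2
      rw [norm_smul, norm_smul, Real.norm_of_nonneg hu, Real.norm_of_nonneg (by linarith)] at h3
      exact norm_le_zero_iff.1 (by nlinarith [mul_le_mul_of_nonneg_left h1 hu])
    rw [ContinuousLinearMap.det]
    intro h0
    have := LinearMap.bot_lt_ker_of_det_eq_zero h0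
    rw [LinearMap.ker_eq_bot.2 hinj] at this
    exact lt_irrefl _ this
  obtain ⟨p, -, hp⟩ := exists_polynomial_eval_eq_det_add_smul (I - fderiv ℝ π x) I
  rw [← hp]
  by_contra hneg
  obtain ⟨u, hu, hu0⟩ := intermediate_value_Icc' hs p.continuous.continuousOn
    (show (0 : ℝ) ∈ Set.Icc (p.eval s) (p.eval 0) from
      ⟨not_lt.1 hneg, by rw [hp, zero_smul, add_zero]; simp [I, ContinuousLinearMap.det]⟩)
  exact hne u hu.1 ((hp u).symm.trans hu0)

theorem volume_infDist_le_expansion (hπ : IsMetricProjection C π) {s : ℝ} (hs : 0 ≤ s) (r : ℝ) :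
    volume {x | Metric.infDist x C ≤ (1 + s) * r} =
      ∫⁻ x in {x | Metric.infDist x C ≤ r} ∩ {x | DifferentiableAt ℝ π x},
        ENNReal.ofReal (ContinuousLinearMap.id ℝ (EuclideanSpace ℝ (Fin n)) +
          s • (ContinuousLinearMap.id ℝ _ - fderiv ℝ π x)).det := by
  have hm : MeasurableSet ({x | Metric.infDist x C ≤ r} ∩ {x | DifferentiableAt ℝ π x}) :=
    (measurableSet_le (Metric.continuous_infDist_pt C).measurable measurable_const).inter
      (measurableSet_of_differentiableAt ℝ π)
  have h := lintegral_abs_det_fderiv_eq_addHaar_image volume hm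
    (fun x hx => (hasFDerivAt_expansion hx.2 s).hasFDerivWithinAt)
    (hπ.injective_expansion hs).injOn
  have h' : volume {x | Metric.infDist x C ≤ (1 + s) * r} = volume (expansion π s ''
      ({x | Metric.infDist x C ≤ r} ∩ {x | DifferentiableAt ℝ π x})) := by
    rw [← hπ.expansion_image hs]
    refine le_antisymm ?_ (measure_mono (Set.image_mono Set.inter_subset_left))
    -- By Rademacher's theorem the points of non-differentiability are null, and so is their
    -- Lipschitz image.
    rw [← Set.inter_union_compl {x | Metric.infDist x C ≤ r} {x | DifferentiableAt ℝ π x},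
      Set.image_union]
    refine (measure_union_le _ _).trans ?_
    rw [(hπ.lipschitzWith_expansion s).addHaar_image_eq_zero volume
      (measure_mono_null Set.inter_subset_right hπ.lipschitzWith.ae_differentiableAt), add_zero,
      Set.inter_union_compl]
  rw [h', ← h]
  exact setLIntegral_congr_fun hm fun x hx => by
    rw [abs_of_pos (hπ.det_fderiv_expansion_pos x hs)]

theorem volume_real_infDist_le_expansion (hπ : IsMetricProjection C π) {r : ℝ}
    (hfin : ∀ t, volume {x | Metric.infDist x C ≤ t} < ⊤) {s : ℝ} (hs : 0 ≤ s) :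
    volume.real {x | Metric.infDist x C ≤ (1 + s) * r} = ∑ j ∈ Finset.range (n + 1),
      volume.real {x | Metric.infDist x C ≤ (1 + j) * r} *
        (Lagrange.basis (Finset.range (n + 1)) (fun j : ℕ => (j : ℝ)) j).eval s := by
  set I := ContinuousLinearMap.id ℝ (EuclideanSpace ℝ (Fin n))
  set S := {x | Metric.infDist x C ≤ r} ∩ {x | DifferentiableAt ℝ π x}
  have hm : MeasurableSet S :=
    (measurableSet_le (Metric.continuous_infDist_pt C).measurable measurable_const).inter
      (measurableSet_of_differentiableAt ℝ π)
  have hmeas : ∀ u : ℝ, Measurable fun x => (I + u • (I - fderiv ℝ π x)).det := fun u =>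
    ContinuousLinearMap.continuous_det.measurable.comp
      (((measurable_fderiv ℝ π).const_sub I).const_smul u |>.const_add I)
  have hpos : ∀ u : ℝ, 0 ≤ u →
      0 ≤ᵐ[volume.restrict S] fun x => (I + u • (I - fderiv ℝ π x)).det := fun u hu =>
    (ae_restrict_iff' hm).2 (.of_forall fun x hx => (hπ.det_fderiv_expansion_pos x hu).le)
  have hint : ∀ u : ℝ, 0 ≤ u →
      IntegrableOn (fun x => (I + u • (I - fderiv ℝ π x)).det) S := fun u hu => by
    refine ⟨(hmeas u).aestronglyMeasurable, ?_⟩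
    rw [hasFiniteIntegral_iff_ofReal (hpos u hu), ← hπ.volume_infDist_le_expansion hu r]
    exact hfin _
  have hreal : ∀ u : ℝ, 0 ≤ u → volume.real {x | Metric.infDist x C ≤ (1 + u) * r} =
      ∫ x in S, (I + u • (I - fderiv ℝ π x)).det := fun u hu => by
    rw [integral_eq_lintegral_of_nonneg_ae (hpos u hu) (hmeas u).aestronglyMeasurable,
      ← hπ.volume_infDist_le_expansion hu r, Measure.real]
  rw [hreal s hs]
  simp only [hreal _ (Nat.cast_nonneg _), ← integral_mul_const]
  rw [← integral_finsetSum _ fun j _ => (hint _ (Nat.cast_nonneg j)).mul_const _]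
  refine integral_congr_ae (.of_forall fun x => ?_)
  obtain ⟨p, hdeg, hp⟩ := exists_polynomial_eval_eq_det_add_smul (I - fderiv ℝ π x) I
  rw [finrank_euclideanSpace_fin] at hdeg
  simpa only [hp] using Polynomial.eval_eq_sum_lagrange_basis_natCast hdeg s

end IsMetricProjection

/-- The expansion starts from the r-parallel body with s = t/r − 1, hence the restriction to t ≥ r.
-/
theorem exists_polynomial_volume_infDist_le_of_le {K : Set (EuclideanSpace ℝ (Fin n))}
    (hconv : Convex ℝ K) (hbdd : Bornology.IsBounded K) (hne : K.Nonempty) {r : ℝ} (hr : 0 < r) :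
    ∃ p : Polynomial ℝ, p.natDegree ≤ n ∧
      ∀ t, r ≤ t → volume.real {x | Metric.infDist x K ≤ t} = p.eval t := by
  obtain ⟨π, hπ⟩ := exists_isMetricProjection hne.closure isClosed_closure.isComplete hconv.closure
  set q : Polynomial ℝ := ∑ j ∈ Finset.range (n + 1),
    Polynomial.C (volume.real {x | Metric.infDist x K ≤ (1 + j) * r}) *
      Lagrange.basis (Finset.range (n + 1)) (fun j : ℕ => (j : ℝ)) j with hq
  refine ⟨q.comp (Polynomial.C r⁻¹ * Polynomial.X - 1), ?_, fun t ht => ?_⟩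
  · have h1 : q.natDegree ≤ n := by
      refine Polynomial.natDegree_sum_le_of_forall_le _ _ fun j hj => ?_
      refine (Polynomial.natDegree_C_mul_le _ _).trans ?_
      rw [Lagrange.natDegree_basis (fun _ _ _ _ h => Nat.cast_injective h) hj]
      simp
    have h2 : (Polynomial.C r⁻¹ * Polynomial.X - 1 : Polynomial ℝ).natDegree ≤ 1 := by
      compute_degree
    calc _ ≤ q.natDegree * (Polynomial.C r⁻¹ * Polynomial.X - 1 : Polynomial ℝ).natDegree :=
          Polynomial.natDegree_comp_le
      _ ≤ n * 1 := Nat.mul_le_mul h1 h2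
      _ = n := mul_one n
  · have hs : 0 ≤ r⁻¹ * t - 1 := by
      rw [sub_nonneg, ← div_eq_inv_mul, one_le_div hr]
      exact ht
    have h := hπ.volume_real_infDist_le_expansion (r := r)
      (fun t => volume_infDist_le_lt_top hbdd.closure hne.closure t) hs
    have e : (1 + (r⁻¹ * t - 1)) * r = t := by field_simp; ring
    simp only [Metric.infDist_closure, e] at h
    rw [h]
    simp [hq, Polynomial.eval_finsetSum]

theorem exists_isSteinerPolynomial {K : Set (EuclideanSpace ℝ (Fin n))}
    (hconv : Convex ℝ K) (hbdd : Bornology.IsBounded K) (hne : K.Nonempty) :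
    ∃ p : Polynomial ℝ, IsSteinerPolynomial K p := by
  obtain ⟨p, hdeg, hp⟩ := exists_polynomial_volume_infDist_le_of_le hconv hbdd hne one_pos
  have hpos : ∀ t : ℝ, 0 < t → volume.real {x | Metric.infDist x K ≤ t} = p.eval t := by
    intro t ht
    obtain ⟨q, -, hq⟩ := exists_polynomial_volume_infDist_le_of_le hconv hbdd hne ht
    -- The polynomials for different starting radii agree on a common half-line, so one serves all t
    -- > 0; t = 0 then follows by continuity.
    have hpq : p = q := Polynomial.eq_of_infinite_eval_eq p q <|
      (Set.Ici_infinite (max 1 t)).mono fun u hu => by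
        rw [Set.mem_ofPred_eq, ← hp u ((le_max_left _ _).trans hu),
          ← hq u ((le_max_right _ _).trans hu)]
    rw [hpq, hq t le_rfl]
  have hset : ∀ t : ℝ, 0 ≤ t →
      {x | Metric.infDist x K ≤ t} = Metric.cthickening t (closure K) := by
    intro t ht
    ext x
    rw [Metric.cthickening_closure, Metric.mem_cthickening_iff, Set.mem_ofPred_eq, Metric.infDist,
      ENNReal.le_ofReal_iff_toReal_le (Metric.infEDist_ne_top hne) ht]
  have hzero : volume.real {x | Metric.infDist x K ≤ 0} = p.eval 0 := by
    have hc : IsCompact (closure K) := hbdd.isCompact_closure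
    have h1 : Filter.Tendsto (fun t => volume.real (Metric.cthickening t (closure K)))
        (nhdsWithin 0 (Set.Ioi 0)) (nhds (volume.real (closure K))) :=
      ((ENNReal.tendsto_toReal hc.measure_lt_top.ne).comp
        (tendsto_measure_cthickening_of_isCompact hc)).mono_left nhdsWithin_le_nhds
    have h2 : Filter.Tendsto (fun t => p.eval t) (nhdsWithin 0 (Set.Ioi 0)) (nhds (p.eval 0)) :=
      p.continuous.continuousAt.tendsto.mono_left nhdsWithin_le_nhds
    rw [hset 0 le_rfl, Metric.cthickening_zero, closure_closure]
    refine tendsto_nhds_unique h1 (h2.congr' ?_)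
    filter_upwards [self_mem_nhdsWithin] with t ht
    rw [← hpos t ht, hset t (le_of_lt ht)]
  refine ⟨p, hdeg, fun t ht => ?_⟩
  rw [Measure.real, volume_parallelSet hconv hne ht]
  refine ⟨(volume_infDist_le_lt_top hbdd hne t).ne, ?_⟩
  rcases ht.eq_or_lt with rfl | ht
  · exact hzero
  · exact hpos t ht

theorem isSteinerPolynomial_steinerPolynomial {K : Set (EuclideanSpace ℝ (Fin n))}
    (hconv : Convex ℝ K) (hbdd : Bornology.IsBounded K) (hne : K.Nonempty) :
    IsSteinerPolynomial K (steinerPolynomial K) := by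
  have h := exists_isSteinerPolynomial hconv hbdd hne
  rw [steinerPolynomial, dif_pos h]
  exact h.choose_spec

end Steiner

/-! ### Density of the standard Gaussian measure -/

section GaussianDensity

variable {E : Type*} [NormedAddCommGroup E] [InnerProductSpace ℝ E] [FiniteDimensional ℝ E]
  [MeasurableSpace E] [BorelSpace E]

theorem stdGaussian_eq_withDensity : stdGaussian E = (volume : Measure E).withDensity fun x =>
    ENNReal.ofReal ((2 * Real.pi) ^ (-(Module.finrank ℝ E / 2 : ℝ)) *
      Real.exp (-(1 / 2) * ‖x‖ ^ 2)) := by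
  set c : ℝ := (2 * Real.pi) ^ (-(Module.finrank ℝ E / 2 : ℝ)) with hc
  have hpos : 0 < c := by positivity
  have hint : Integrable fun x : E => c * Real.exp (-(1 / 2) * ‖x‖ ^ 2) := by
    refine Integrable.const_mul (.of_integral_ne_zero ?_) c
    rw [GaussianFourier.integral_rexp_neg_mul_sq_norm (by norm_num)]
    positivity
  have := isFiniteMeasure_withDensity_ofReal hint.2
  refine Measure.ext_of_charFun ?_
  ext t
  rw [charFun_stdGaussian, charFun_apply, integral_withDensity_eq_integral_toReal_smul
    (by fun_prop) (.of_forall fun _ => ENNReal.ofReal_lt_top)]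
  have h := GaussianFourier.integral_cexp_neg_mul_sq_norm_add (V := E) (b := (1 / 2 : ℂ))
    (by norm_num) Complex.I t
  have e : ∀ x : E, (ENNReal.ofReal (c * Real.exp (-(1 / 2) * ‖x‖ ^ 2))).toReal •
      Complex.exp (inner ℝ x t * Complex.I) =
      c * Complex.exp (-(1 / 2) * ‖x‖ ^ 2 + Complex.I * inner ℝ t x) := fun x => by
    rw [ENNReal.toReal_ofReal (by positivity), Complex.real_smul, Complex.exp_add,
      real_inner_comm t x]
    push_cast
    ring_nf
  have hcc : (c : ℂ) * (Real.pi / (1 / 2) : ℂ) ^ (Module.finrank ℝ E / 2 : ℂ) = 1 := by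
    have e1 : (Real.pi / (1 / 2) : ℂ) = ((2 * Real.pi : ℝ) : ℂ) := by push_cast; ring
    have e2 : (Module.finrank ℝ E / 2 : ℂ) = ((Module.finrank ℝ E / 2 : ℝ) : ℂ) := by push_cast; ring
    rw [e1, e2, ← Complex.ofReal_cpow (by positivity), ← Complex.ofReal_mul, hc,
      ← Real.rpow_add (by positivity), neg_add_cancel, Real.rpow_zero, Complex.ofReal_one]
  simp_rw [e]
  rw [integral_const_mul, h, ← mul_assoc, hcc, one_mul, Complex.I_sq]
  congr 1
  ring

/-- Fernique's theorem together with c‖x‖ ≤ C‖x‖² + c²/(4C). -/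
theorem integrable_exp_mul_norm_stdGaussian (c : ℝ) :
    Integrable (fun x : E => Real.exp (c * ‖x‖)) (stdGaussian E) := by
  obtain ⟨C, hC, h⟩ := IsGaussian.exists_integrable_exp_sq (stdGaussian E)
  refine (h.const_mul (Real.exp (c ^ 2 / (4 * C)))).mono' (by fun_prop) (.of_forall fun x => ?_)
  rw [Real.norm_of_nonneg (Real.exp_nonneg _), ← Real.exp_add, Real.exp_le_exp]
  have e : c ^ 2 / (4 * C) + C * ‖x‖ ^ 2 - c * ‖x‖ = (2 * C * ‖x‖ - c) ^ 2 / (4 * C) := by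
    field_simp
    ring
  have : 0 ≤ (2 * C * ‖x‖ - c) ^ 2 / (4 * C) := by positivity
  linarith

end GaussianDensity

/-! ### Integrating a Gaussian function of the distance -/

section LayerCake

theorem unitBallVolume_pos (k : ℕ) : 0 < unitBallVolume k :=
  div_pos (by positivity) (Real.Gamma_pos_of_pos (by positivity))

/-- The weight is minus the derivative of exp(−πt²). Its moments are exactly 1/ω_i, which produces
the normalization of the intrinsic volumes. -/
theorem integral_pow_mul_exp_neg_pi_mul_sq (i : ℕ) :
    ∫ t in Set.Ioi (0 : ℝ), t ^ i * (2 * Real.pi * t * Real.exp (-Real.pi * t ^ 2)) =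
      (unitBallVolume i)⁻¹ := by
  have h := integral_rpow_mul_exp_neg_mul_rpow (p := 2) (q := i + 1) (b := Real.pi) two_pos
    (by linarith [i.cast_nonneg (α := ℝ)]) Real.pi_pos
  have e : ∀ t ∈ Set.Ioi (0 : ℝ), t ^ i * (2 * Real.pi * t * Real.exp (-Real.pi * t ^ 2)) =
      2 * Real.pi * (t ^ ((i : ℝ) + 1) * Real.exp (-Real.pi * t ^ (2 : ℝ))) := fun t ht => by
    rw [Real.rpow_add ht, Real.rpow_natCast, Real.rpow_one, Real.rpow_two]
    ring
  rw [setIntegral_congr_fun measurableSet_Ioi e, integral_const_mul, h, unitBallVolume, inv_div]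
  have e1 : -((i : ℝ) + 1 + 1) / 2 = -((i : ℝ) / 2) - 1 := by ring
  have e2 : ((i : ℝ) + 1 + 1) / 2 = (i : ℝ) / 2 + 1 := by ring
  rw [e1, e2, Real.rpow_sub_one Real.pi_ne_zero, Real.rpow_neg Real.pi_pos.le]
  field_simp

theorem integrableOn_pow_mul_exp_neg_pi_mul_sq (i : ℕ) : IntegrableOn
    (fun t : ℝ => t ^ i * (2 * Real.pi * t * Real.exp (-Real.pi * t ^ 2))) (Set.Ioi 0) :=
  -- The integral of a non-integrable function is 0 by convention, so a nonzero value proves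
  -- integrability.
  .of_integral_ne_zero (by
    rw [integral_pow_mul_exp_neg_pi_mul_sq]
    exact inv_ne_zero (unitBallVolume_pos i).ne')

theorem lintegral_Ici_two_pi_mul_exp_neg_pi_mul_sq {a : ℝ} (ha : 0 ≤ a) :
    ∫⁻ t in Set.Ici a, ENNReal.ofReal (2 * Real.pi * t * Real.exp (-Real.pi * t ^ 2)) =
      ENNReal.ofReal (Real.exp (-Real.pi * a ^ 2)) := by
  have hderiv : ∀ t : ℝ, HasDerivAt (fun t => -Real.exp (-Real.pi * t ^ 2))
      (2 * Real.pi * t * Real.exp (-Real.pi * t ^ 2)) t := fun t => by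
    have := (((hasDerivAt_pow 2 t).const_mul (-Real.pi)).exp).neg
    refine this.congr_deriv ?_
    push_cast
    ring
  have hlim : Filter.Tendsto (fun t : ℝ => -Real.exp (-Real.pi * t ^ 2)) Filter.atTop (nhds 0) := by
    rw [← neg_zero]
    refine (Real.tendsto_exp_atBot.comp ?_).neg
    exact (Filter.tendsto_pow_atTop two_ne_zero).const_mul_atTop_of_neg (by linarith [Real.pi_pos])
  have hnn : ∀ t ∈ Set.Ioi a, 0 ≤ 2 * Real.pi * t * Real.exp (-Real.pi * t ^ 2) := fun t ht => by
    have : 0 ≤ t := ha.trans (le_of_lt ht)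
    positivity
  have hint := integrableOn_Ioi_deriv_of_nonneg' (fun t _ => hderiv t) hnn hlim
  rw [setLIntegral_congr Ioi_ae_eq_Ici.symm, ← ofReal_integral_eq_lintegral_ofReal hint
    ((ae_restrict_iff' measurableSet_Ioi).2 (.of_forall hnn)),
    integral_Ioi_of_hasDerivAt_of_nonneg' (fun t _ => hderiv t) hnn hlim, zero_sub, neg_neg]

/-- Layer cake: write exp(−πf²) as the integral of the weight over t ≥ f, swap the integrals, and
integrate the sublevel volumes term by term. -/
theorem integral_exp_neg_pi_mul_sq_eq_sum {X : Type*} [MeasurableSpace X] {μ : Measure X}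
    [SFinite μ] {f : X → ℝ} (hf : Measurable f) (hf0 : ∀ x, 0 ≤ f x)
    (hfin : ∀ t, μ {x | f x ≤ t} ≠ ⊤) {n : ℕ} {a : ℕ → ℝ}
    (ha : ∀ t, 0 < t → μ.real {x | f x ≤ t} = ∑ i ∈ Finset.range n, a i * t ^ i) :
    ∫ x, Real.exp (-Real.pi * f x ^ 2) ∂μ = ∑ i ∈ Finset.range n, a i / unitBallVolume i := by
  set g : ℝ → ℝ := fun t => 2 * Real.pi * t * Real.exp (-Real.pi * t ^ 2) with hg
  have hgm : Measurable g := by fun_prop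
  have key : ∫⁻ x, ENNReal.ofReal (Real.exp (-Real.pi * f x ^ 2)) ∂μ =
      ∫⁻ t in Set.Ioi 0, ENNReal.ofReal ((∑ i ∈ Finset.range n, a i * t ^ i) * g t) := by
    have e1 : ∀ x, ENNReal.ofReal (Real.exp (-Real.pi * f x ^ 2)) =
        ∫⁻ t in Set.Ioi 0, {p : X × ℝ | f p.1 ≤ p.2}.indicator
          (fun p => ENNReal.ofReal (g p.2)) (x, t) := fun x => by
      rw [← lintegral_Ici_two_pi_mul_exp_neg_pi_mul_sq (hf0 x),
        setLIntegral_congr (Ioi_ae_eq_Ici (a := (0 : ℝ)))]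
      have : Set.Ici (f x) = Set.Ici (f x) ∩ Set.Ici 0 :=
        (Set.inter_eq_left.2 (Set.Ici_subset_Ici.2 (hf0 x))).symm
      rw [this, ← setLIntegral_indicator measurableSet_Ici]
      rfl
    have hm : Measurable ({p : X × ℝ | f p.1 ≤ p.2}.indicator
        (fun p => ENNReal.ofReal (g p.2))) :=
      (hgm.comp measurable_snd).ennreal_ofReal.indicator
        (measurableSet_le (hf.comp measurable_fst) measurable_snd)
    simp_rw [e1]
    rw [lintegral_lintegral_swap (f := fun x t => {p : X × ℝ | f p.1 ≤ p.2}.indicator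
      (fun p => ENNReal.ofReal (g p.2)) (x, t)) hm.aemeasurable]
    refine setLIntegral_congr_fun measurableSet_Ioi fun t ht => ?_
    have e2 : (fun x => {p : X × ℝ | f p.1 ≤ p.2}.indicator
        (fun p => ENNReal.ofReal (g p.2)) (x, t)) =
        {x | f x ≤ t}.indicator fun _ => ENNReal.ofReal (g t) := rfl
    simp only [e2]
    rw [lintegral_indicator_const (measurableSet_le hf measurable_const), ← ha t ht,
      ENNReal.ofReal_mul measureReal_nonneg, Measure.real, ENNReal.ofReal_toReal (hfin t), mul_comm]
  rw [integral_eq_lintegral_of_nonneg_ae (.of_forall fun _ => (Real.exp_nonneg _)) (by fun_prop),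
    key, ← integral_eq_lintegral_of_nonneg_ae]
  · have e3 : ∀ t : ℝ, (∑ i ∈ Finset.range n, a i * t ^ i) * g t =
        ∑ i ∈ Finset.range n, a i * (t ^ i * g t) := fun t => by
      rw [Finset.sum_mul]
      exact Finset.sum_congr rfl fun i _ => mul_assoc _ _ _
    simp_rw [e3]
    rw [integral_finsetSum _ fun i _ => (integrableOn_pow_mul_exp_neg_pi_mul_sq i).const_mul _]
    refine Finset.sum_congr rfl fun i _ => ?_
    rw [integral_const_mul, integral_pow_mul_exp_neg_pi_mul_sq, div_eq_mul_inv]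
  · refine (ae_restrict_iff' measurableSet_Ioi).2 (.of_forall fun t ht => ?_)
    have : (0 : ℝ) < t := ht
    simp only [← ha t ht]
    exact mul_nonneg measureReal_nonneg (by positivity)
  · exact Measurable.aestronglyMeasurable (by fun_prop)

end LayerCake

/-! ### Support functions -/

section SupportFunction

variable {E : Type*} [NormedAddCommGroup E] [InnerProductSpace ℝ E]

/-- The support function `z ↦ sup_{y ∈ K} ⟨z, y⟩`. -/
noncomputable def supportFunction (K : Set E) (z : E) : ℝ :=
  sSup ((fun y => inner ℝ z y) '' K)

variable {K : Set E} {R : ℝ}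

theorem bddAbove_inner_image (hR : ∀ y ∈ K, ‖y‖ ≤ R) (z : E) :
    BddAbove ((fun y => inner ℝ z y) '' K) := by
  refine ⟨‖z‖ * R, ?_⟩
  rintro _ ⟨y, hy, rfl⟩
  exact (real_inner_le_norm z y).trans (mul_le_mul_of_nonneg_left (hR y hy) (norm_nonneg z))

theorem inner_le_supportFunction (hR : ∀ y ∈ K, ‖y‖ ≤ R) (z : E) {y : E} (hy : y ∈ K) :
    inner ℝ z y ≤ supportFunction K z :=
  le_csSup (bddAbove_inner_image hR z) (Set.mem_image_of_mem _ hy)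

theorem supportFunction_le (hne : K.Nonempty) {z : E} {c : ℝ} (h : ∀ y ∈ K, inner ℝ z y ≤ c) :
    supportFunction K z ≤ c :=
  csSup_le (hne.image _) (by rintro _ ⟨y, hy, rfl⟩; exact h y hy)

theorem abs_supportFunction_le (hne : K.Nonempty) (hR : ∀ y ∈ K, ‖y‖ ≤ R) (z : E) :
    |supportFunction K z| ≤ R * ‖z‖ := by
  have h : ∀ y ∈ K, |inner ℝ z y| ≤ R * ‖z‖ := fun y hy =>
    (abs_real_inner_le_norm z y).trans
      ((mul_comm _ _).trans_le (mul_le_mul_of_nonneg_right (hR y hy) (norm_nonneg z)))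
  refine abs_le.2 ⟨?_, supportFunction_le hne fun y hy => (abs_le.1 (h y hy)).2⟩
  obtain ⟨y, hy⟩ := hne
  exact (abs_le.1 (h y hy)).1.trans (inner_le_supportFunction hR z hy)

theorem continuous_supportFunction (hne : K.Nonempty) (hR : ∀ y ∈ K, ‖y‖ ≤ R) :
    Continuous (supportFunction K) := by
  have hR0 : 0 ≤ R := (norm_nonneg _).trans (hR _ hne.some_mem)
  refine (LipschitzWith.of_le_add_mul ⟨R, hR0⟩ fun z w => supportFunction_le hne fun y hy => ?_).continuous
  have e : inner ℝ z y = inner ℝ w y + inner ℝ (z - w) y := by rw [← inner_add_left]; abel_nf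
  rw [e, dist_eq_norm]
  refine add_le_add (inner_le_supportFunction hR w hy) ((real_inner_le_norm _ _).trans ?_)
  rw [mul_comm]
  exact mul_le_mul_of_nonneg_right (hR y hy) (norm_nonneg _)

theorem norm_sq_sub_infDist_smul_sq_le (hne : K.Nonempty) (hR : ∀ y ∈ K, ‖y‖ ≤ R) {s : ℝ}
    (hs : 0 ≤ s) (z : E) :
    (‖z‖ ^ 2 - Metric.infDist z (s • K) ^ 2) / 2 ≤ s * supportFunction K z := by
  -- `Real.sqrt` is 0 on negative numbers, so no sign condition on the radicand is needed. The bound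
  -- drops ‖s • y‖² from ‖z − s • y‖².
  have h : Real.sqrt (‖z‖ ^ 2 - 2 * (s * supportFunction K z)) ≤ Metric.infDist z (s • K) := by
    refine (Metric.le_infDist (hne.smul_set)).2 ?_
    rintro _ ⟨y, hy, rfl⟩
    refine Real.sqrt_le_iff.2 ⟨dist_nonneg, ?_⟩
    have h1 := mul_le_mul_of_nonneg_left (inner_le_supportFunction hR z hy) hs
    simp only [dist_eq_norm]
    rw [norm_sub_sq_real, inner_smul_right]
    nlinarith [sq_nonneg ‖s • y‖]
  have := (Real.sqrt_le_left Metric.infDist_nonneg).1 h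
  linarith

theorem le_norm_sq_sub_infDist_smul_sq (hne : K.Nonempty) (hR : ∀ y ∈ K, ‖y‖ ≤ R) {s : ℝ}
    (hs : 0 < s) (z : E) :
    s * supportFunction K z - s ^ 2 * R ^ 2 / 2 ≤
      (‖z‖ ^ 2 - Metric.infDist z (s • K) ^ 2) / 2 := by
  rw [sub_le_iff_le_add, ← le_div_iff₀' hs]
  refine supportFunction_le hne fun y hy => ?_
  rw [le_div_iff₀' hs]
  have h1 : Metric.infDist z (s • K) ≤ ‖z - s • y‖ := by
    rw [← dist_eq_norm]
    exact Metric.infDist_le_dist_of_mem (Set.smul_mem_smul_set hy)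
  have h2 := pow_le_pow_left₀ Metric.infDist_nonneg h1 2
  rw [norm_sub_sq_real, inner_smul_right, norm_smul, mul_pow, Real.norm_eq_abs, sq_abs] at h2
  have h3 := mul_le_mul_of_nonneg_left (pow_le_pow_left₀ (norm_nonneg y) (hR y hy) 2) (sq_nonneg s)
  linarith

theorem Real.abs_exp_sub_one_le_mul_exp (a : ℝ) : |Real.exp a - 1| ≤ |a| * Real.exp |a| := by
  have h1 := Real.add_one_le_exp a
  have h2 : Real.exp a - 1 ≤ a * Real.exp a := by
    have := mul_le_mul_of_nonneg_right (Real.add_one_le_exp (-a)) (Real.exp_nonneg a)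
    rw [← Real.exp_add, neg_add_cancel, Real.exp_zero] at this
    linarith
  have h3 : 1 ≤ Real.exp |a| := Real.one_le_exp (abs_nonneg a)
  refine abs_le.2 ⟨?_, h2.trans ?_⟩
  · nlinarith [neg_abs_le a, abs_nonneg a]
  · exact mul_le_mul (le_abs_self a) (Real.exp_le_exp.2 (le_abs_self a)) (Real.exp_nonneg a)
      (abs_nonneg a)

theorem tendsto_exp_norm_sq_sub_infDist_sq_slope (hne : K.Nonempty) (hR : ∀ y ∈ K, ‖y‖ ≤ R)
    (z : E) : Filter.Tendsto
      (fun s : ℝ => (Real.exp ((‖z‖ ^ 2 - Metric.infDist z (s • K) ^ 2) / 2) - 1) / s)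
      (nhdsWithin 0 (Set.Ioi 0)) (nhds (supportFunction K z)) := by
  have hlow : Filter.Tendsto (fun s : ℝ => supportFunction K z - s * R ^ 2 / 2)
      (nhdsWithin 0 (Set.Ioi 0)) (nhds (supportFunction K z)) := by
    have : Continuous fun s : ℝ => supportFunction K z - s * R ^ 2 / 2 := by fun_prop
    simpa using (this.tendsto 0).mono_left nhdsWithin_le_nhds
  have hup : Filter.Tendsto (fun s : ℝ => (Real.exp (s * supportFunction K z) - 1) / s)
      (nhdsWithin 0 (Set.Ioi 0)) (nhds (supportFunction K z)) := by
    have h : HasDerivAt (fun s : ℝ => Real.exp (s * supportFunction K z)) (supportFunction K z) 0 := by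
      simpa using ((hasDerivAt_id (0 : ℝ)).mul_const (supportFunction K z)).exp
    simpa [div_eq_inv_mul] using h.tendsto_slope_zero_right
  refine tendsto_of_tendsto_of_tendsto_of_le_of_le' hlow hup ?_ ?_
  · filter_upwards [self_mem_nhdsWithin] with s hs
    rw [le_div_iff₀ hs]
    have h1 := le_norm_sq_sub_infDist_smul_sq hne hR hs z
    have h2 := Real.add_one_le_exp ((‖z‖ ^ 2 - Metric.infDist z (s • K) ^ 2) / 2)
    linarith
  · filter_upwards [self_mem_nhdsWithin] with s hs
    have hs' : (0 : ℝ) < s := hs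
    gcongr
    exact norm_sq_sub_infDist_smul_sq_le hne hR hs'.le z

theorem abs_norm_sq_sub_infDist_sq_le (hne : K.Nonempty) (hR : ∀ y ∈ K, ‖y‖ ≤ R) {s : ℝ}
    (hs : 0 < s) (hs1 : s ≤ 1) (z : E) :
    |(‖z‖ ^ 2 - Metric.infDist z (s • K) ^ 2) / 2| ≤ s * (R * ‖z‖ + R ^ 2 / 2) := by
  have h1 := norm_sq_sub_infDist_smul_sq_le hne hR hs.le z
  have h2 := le_norm_sq_sub_infDist_smul_sq hne hR hs z
  have h3 := abs_le.1 (abs_supportFunction_le hne hR z)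
  have h4 : s ^ 2 * R ^ 2 / 2 ≤ s * (R ^ 2 / 2) := by
    nlinarith [mul_nonneg (mul_nonneg hs.le (sub_nonneg.2 hs1)) (sq_nonneg R)]
  have h5 : 0 ≤ s * (R ^ 2 / 2) := by positivity
  refine abs_le.2 ⟨?_, ?_⟩
  · nlinarith [mul_le_mul_of_nonneg_left h3.1 hs.le]
  · nlinarith [mul_le_mul_of_nonneg_left h3.2 hs.le]

/-- After division by s the bound no longer depends on s, which supplies the dominating function for
the difference quotients. -/
theorem abs_exp_norm_sq_sub_infDist_sq_sub_one_le (hne : K.Nonempty) (hR : ∀ y ∈ K, ‖y‖ ≤ R)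
    {s : ℝ} (hs : 0 < s) (hs1 : s ≤ 1) (z : E) :
    |(Real.exp ((‖z‖ ^ 2 - Metric.infDist z (s • K) ^ 2) / 2) - 1)| ≤
      s * (Real.exp (R ^ 2) * Real.exp (2 * R * ‖z‖)) := by
  have hR0 : 0 ≤ R := (norm_nonneg _).trans (hR _ hne.some_mem)
  set b := R * ‖z‖ + R ^ 2 / 2 with hb
  have hb0 : 0 ≤ b := by positivity
  have h := abs_norm_sq_sub_infDist_sq_le hne hR hs hs1 z
  have h' := h.trans (mul_le_of_le_one_left hb0 hs1)
  calc _ ≤ _ := Real.abs_exp_sub_one_le_mul_exp _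
    _ ≤ (s * b) * Real.exp b := by gcongr
    _ ≤ (s * Real.exp b) * Real.exp b := by
        gcongr
        linarith [Real.add_one_le_exp b]
    _ = s * (Real.exp (R ^ 2) * Real.exp (2 * R * ‖z‖)) := by
        rw [mul_assoc, ← Real.exp_add, ← Real.exp_add, hb]
        ring_nf

variable [MeasurableSpace E] [BorelSpace E] {μ : Measure E}

theorem integrable_supportFunction (hne : K.Nonempty) (hR : ∀ y ∈ K, ‖y‖ ≤ R)
    (hμ : Integrable (fun z => Real.exp (2 * R * ‖z‖)) μ) : Integrable (supportFunction K) μ := by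
  have hR0 : 0 ≤ R := (norm_nonneg _).trans (hR _ hne.some_mem)
  refine hμ.mono' (continuous_supportFunction hne hR).aestronglyMeasurable (.of_forall fun z => ?_)
  have h0 : 0 ≤ R * ‖z‖ := by positivity
  exact (abs_supportFunction_le hne hR z).trans
    (by linarith [Real.add_one_le_exp (2 * R * ‖z‖)])

theorem tendsto_integral_exp_norm_sq_sub_infDist_sq_slope (hne : K.Nonempty)
    (hR : ∀ y ∈ K, ‖y‖ ≤ R) [IsProbabilityMeasure μ]
    (hμ : Integrable (fun z => Real.exp (2 * R * ‖z‖)) μ) : Filter.Tendsto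
      (fun s : ℝ => (∫ z, Real.exp ((‖z‖ ^ 2 - Metric.infDist z (s • K) ^ 2) / 2) ∂μ - 1) / s)
      (nhdsWithin 0 (Set.Ioi 0)) (nhds (∫ z, supportFunction K z ∂μ)) := by
  have hcont : ∀ s : ℝ, Continuous fun z : E =>
      Real.exp ((‖z‖ ^ 2 - Metric.infDist z (s • K) ^ 2) / 2) := fun s => by
    have := Metric.continuous_infDist_pt (s • K)
    fun_prop
  have hev : ∀ᶠ s : ℝ in nhdsWithin 0 (Set.Ioi 0), 0 < s ∧ s ≤ 1 := by
    filter_upwards [Ioc_mem_nhdsGT (zero_lt_one (α := ℝ))] with s hs using hs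
  have h := tendsto_integral_filter_of_dominated_convergence
    (fun z => Real.exp (R ^ 2) * Real.exp (2 * R * ‖z‖))
    (F := fun s z => (Real.exp ((‖z‖ ^ 2 - Metric.infDist z (s • K) ^ 2) / 2) - 1) / s)
    (l := nhdsWithin 0 (Set.Ioi 0)) (μ := μ) (f := supportFunction K)
    (.of_forall fun s => (((hcont s).sub continuous_const).div_const s).aestronglyMeasurable)
    (hev.mono fun s hs => .of_forall fun z => by
      rw [norm_div, Real.norm_of_nonneg hs.1.le, div_le_iff₀' hs.1]
      exact abs_exp_norm_sq_sub_infDist_sq_sub_one_le hne hR hs.1 hs.2 z)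
    (hμ.const_mul _) (.of_forall fun z => tendsto_exp_norm_sq_sub_infDist_sq_slope hne hR z)
  refine h.congr' (hev.mono fun s hs => ?_)
  have hint : Integrable
      (fun z => Real.exp ((‖z‖ ^ 2 - Metric.infDist z (s • K) ^ 2) / 2) - 1) μ :=
    ((hμ.const_mul (Real.exp (R ^ 2))).const_mul s).mono'
      ((hcont s).sub continuous_const).aestronglyMeasurable
      (.of_forall fun z => abs_exp_norm_sq_sub_infDist_sq_sub_one_le hne hR hs.1 hs.2 z)
  have hint' : Integrable (fun z => Real.exp ((‖z‖ ^ 2 - Metric.infDist z (s • K) ^ 2) / 2)) μ := by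
    refine (hint.add (integrable_const (1 : ℝ))).congr (.of_forall fun z => ?_)
    simp
  rw [integral_div, integral_sub hint' (integrable_const _)]
  simp

end SupportFunction

/-! ### The generating polynomial of the intrinsic volumes and its derivative at zero -/

section IntrinsicVolume

variable {n : ℕ} {K : Set (EuclideanSpace ℝ (Fin n))}

/-- The factor exp(‖z‖²/2) cancels the Gaussian density; substituting z = c x and using c²/2 =
π(c/√(2π))² gives the rest. -/
theorem integral_exp_norm_sq_sub_infDist_sq_stdGaussian {c : ℝ} (hc : 0 < c) :
    ∫ z, Real.exp ((‖z‖ ^ 2 - Metric.infDist z (c • K) ^ 2) / 2)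
      ∂(stdGaussian (EuclideanSpace ℝ (Fin n))) =
    (c / Real.sqrt (2 * Real.pi)) ^ n *
      ∫ x, Real.exp (-Real.pi * (c / Real.sqrt (2 * Real.pi) * Metric.infDist x K) ^ 2) := by
  have hcont := Metric.continuous_infDist_pt K
  rw [stdGaussian_eq_withDensity, integral_withDensity_eq_integral_toReal_smul
    (by fun_prop) (.of_forall fun _ => ENNReal.ofReal_lt_top), finrank_euclideanSpace_fin]
  have hden : (2 * Real.pi) ^ (-(n / 2 : ℝ)) = (Real.sqrt (2 * Real.pi) ^ n)⁻¹ := by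
    rw [Real.rpow_neg (by positivity), Real.sqrt_eq_rpow, ← Real.rpow_natCast, ← Real.rpow_mul
      (by positivity)]
    ring_nf
  have hs : Real.sqrt (2 * Real.pi) ^ 2 = 2 * Real.pi := Real.sq_sqrt (by positivity)
  have hs0 : 0 < Real.sqrt (2 * Real.pi) := by positivity
  set σ := Real.sqrt (2 * Real.pi)
  have e : ∀ z : EuclideanSpace ℝ (Fin n), (ENNReal.ofReal ((2 * Real.pi) ^ (-(n / 2 : ℝ)) *
      Real.exp (-(1 / 2) * ‖z‖ ^ 2))).toReal •
      Real.exp ((‖z‖ ^ 2 - Metric.infDist z (c • K) ^ 2) / 2) =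
      (σ ^ n)⁻¹ * Real.exp (-Real.pi * (c / σ * Metric.infDist (c⁻¹ • z) K) ^ 2) := fun z => by
    have h := infDist_smul₀ hc.ne' K (c⁻¹ • z)
    rw [smul_inv_smul₀ hc.ne', Real.norm_of_nonneg hc.le] at h
    rw [ENNReal.toReal_ofReal (by positivity), hden, smul_eq_mul, mul_assoc, ← Real.exp_add, h]
    congr 2
    rw [mul_pow, mul_pow, div_pow, hs]
    field_simp
    ring
  simp_rw [e]
  rw [integral_const_mul, Measure.integral_comp_smul volume
    (fun x : EuclideanSpace ℝ (Fin n) => Real.exp (-Real.pi * (c / σ * Metric.infDist x K) ^ 2)),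
    finrank_euclideanSpace_fin, inv_pow, inv_inv, abs_of_pos (by positivity), smul_eq_mul,
    div_pow]
  ring

theorem IsSteinerPolynomial.integral_exp_neg_pi_mul_infDist_sq {p : Polynomial ℝ}
    (hp : IsSteinerPolynomial K p) (hconv : Convex ℝ K) (hbdd : Bornology.IsBounded K)
    (hne : K.Nonempty) {s : ℝ} (hs : 0 < s) :
    s ^ n * ∫ x, Real.exp (-Real.pi * (s * Metric.infDist x K) ^ 2) =
      ∑ i ∈ Finset.range (n + 1), p.coeff i / unitBallVolume i * s ^ (n - i) := by
  have hset : ∀ t, {x | s * Metric.infDist x K ≤ t} = {x | Metric.infDist x K ≤ t / s} := fun t => by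
    ext x
    rw [Set.mem_ofPred_eq, Set.mem_ofPred_eq, le_div_iff₀' hs]
  rw [integral_exp_neg_pi_mul_sq_eq_sum (n := n + 1) (a := fun i => p.coeff i * (s ^ i)⁻¹)
    ((Metric.continuous_infDist_pt K).measurable.const_mul s)
    (fun x => mul_nonneg hs.le Metric.infDist_nonneg)
    (fun t => by rw [hset]; exact (volume_infDist_le_lt_top hbdd hne _).ne), Finset.mul_sum]
  · refine Finset.sum_congr rfl fun i hi => ?_
    rw [pow_sub₀ s hs.ne' (Nat.lt_succ_iff.1 (Finset.mem_range.1 hi))]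
    ring
  · intro t ht
    have ht' : 0 ≤ t / s := by positivity
    rw [hset, Measure.real, ← volume_parallelSet hconv hne ht', ← Measure.real,
      (hp.2 _ ht').2, Polynomial.eval_eq_sum_range' (Nat.lt_succ_of_le hp.1)]
    refine Finset.sum_congr rfl fun i _ => ?_
    rw [div_pow, div_eq_mul_inv]
    ring

theorem intrinsicVolume_one_eq_integral_supportFunction (hconv : Convex ℝ K)
    (hbdd : Bornology.IsBounded K) (hne : K.Nonempty) :
    intrinsicVolume 1 K = Real.sqrt (2 * Real.pi) *
      ∫ z, supportFunction K z ∂(stdGaussian (EuclideanSpace ℝ (Fin n))) := by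
  obtain ⟨R, hR⟩ := hbdd.exists_norm_le
  have hp := isSteinerPolynomial_steinerPolynomial hconv hbdd hne
  set p := steinerPolynomial K with hpdef
  have hσ : 0 < Real.sqrt (2 * Real.pi) := by positivity
  set σ := Real.sqrt (2 * Real.pi)
  set I := ∫ z, supportFunction K z ∂(stdGaussian (EuclideanSpace ℝ (Fin n)))
  let Q : Polynomial ℝ := ∑ i ∈ Finset.range (n + 1),
    Polynomial.C (p.coeff i / unitBallVolume i) * Polynomial.X ^ (n - i)
  -- Only i = n − 1 contributes, where the two binomial coefficients cancel. For n = 0 both sides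
  -- vanish.
  have hcoeff : Q.coeff 1 = intrinsicVolume 1 K := by
    rw [Polynomial.finsetSum_coeff, intrinsicVolume, quermassintegral, ← hpdef]
    simp only [Polynomial.coeff_C_mul, Polynomial.coeff_X_pow]
    cases n with
    | zero => simp
    | succ m =>
      rw [Finset.sum_eq_single m]
      · have : ((m : ℝ) + 1) ≠ 0 := by positivity
        simp
        field_simp
      · intro i hi him
        rw [if_neg (by simp at hi; omega), mul_zero]
      · simp
  have hslope : Filter.Tendsto (fun s : ℝ => (Q.eval s - 1) / s) (nhdsWithin 0 (Set.Ioi 0))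
      (nhds (σ * I)) := by
    have h := tendsto_integral_exp_norm_sq_sub_infDist_sq_slope (μ := stdGaussian _) hne hR
      (integrable_exp_mul_norm_stdGaussian (2 * R))
    have hmul : Filter.Tendsto (fun s : ℝ => σ * s) (nhdsWithin 0 (Set.Ioi 0))
        (nhdsWithin 0 (Set.Ioi 0)) := by
      refine tendsto_nhdsWithin_iff.2 ⟨?_, ?_⟩
      · have : Continuous fun s : ℝ => σ * s := by fun_prop
        simpa using (this.tendsto 0).mono_left nhdsWithin_le_nhds
      · filter_upwards [self_mem_nhdsWithin] with s hs using mul_pos hσ hs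
    refine ((h.comp hmul).const_mul σ).congr' ?_
    filter_upwards [self_mem_nhdsWithin] with s hs
    have hs' : (0 : ℝ) < s := hs
    rw [Function.comp_apply, integral_exp_norm_sq_sub_infDist_sq_stdGaussian (mul_pos hσ hs'),
      mul_div_cancel_left₀ _ hσ.ne', hp.integral_exp_neg_pi_mul_infDist_sq hconv hbdd hne hs']
    simp only [Q, Polynomial.eval_finsetSum, Polynomial.eval_mul, Polynomial.eval_C,
      Polynomial.eval_pow, Polynomial.eval_X]
    field_simp
  have hid : Filter.Tendsto (fun s : ℝ => s) (nhdsWithin 0 (Set.Ioi 0)) (nhds 0) :=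
    tendsto_nhdsWithin_of_tendsto_nhds Filter.tendsto_id
  -- A convergent quotient forces its numerator to tend to 0, so V_0 = 1 need not be computed
  -- directly.
  have hQ0 : Q.eval 0 = 1 := by
    have h1 := (hslope.mul hid).add_const 1
    rw [mul_zero, zero_add] at h1
    refine tendsto_nhds_unique ((Q.continuous.tendsto 0).mono_left nhdsWithin_le_nhds) (h1.congr' ?_)
    filter_upwards [self_mem_nhdsWithin] with s hs
    have hs' : (0 : ℝ) < s := hs
    field_simp
    ring
  have hder : Filter.Tendsto (fun s : ℝ => (Q.eval s - 1) / s) (nhdsWithin 0 (Set.Ioi 0))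
      (nhds (Q.derivative.eval 0)) := by
    simpa [hQ0, div_eq_inv_mul] using (Q.hasDerivAt 0).tendsto_slope_zero_right
  rw [← hcoeff, tendsto_nhds_unique hslope hder, ← Polynomial.coeff_zero_eq_eval_zero,
    Polynomial.coeff_derivative]
  simp

end IntrinsicVolume

/-- For a nonempty bounded convex set `K` in `ℝ^n` and `Z ~ N(0, I_n)`: Steiner's formula holds
for `K` (so that the intrinsic volumes of `K` are meaningful), the supremum of `⟨Z, y⟩` over
`y ∈ √(2π) K` is integrable, and its expectation is `V_1(K)`. -/
theorem mainTheorem9 {n : ℕ} (K : Set (EuclideanSpace ℝ (Fin n)))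
    (hconv : Convex ℝ K) (hbdd : Bornology.IsBounded K) (hne : K.Nonempty)
    {Ω : Type*} [MeasurableSpace Ω] (P : Measure Ω) (Z : Ω → EuclideanSpace ℝ (Fin n))
    (hZ : HasLaw Z (stdGaussian (EuclideanSpace ℝ (Fin n))) P) :
    (∀ t : ℝ, 0 ≤ t →
      volume (parallelSet K t) ≠ ⊤ ∧
      volume.real (parallelSet K t) =
        ∑ i ∈ Finset.range (n + 1), (n.choose i : ℝ) * quermassintegral K i * t ^ i) ∧
    Integrable
      (fun ω => sSup ((fun y => inner ℝ (Z ω) y) '' (Real.sqrt (2 * Real.pi) • K))) P ∧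
    intrinsicVolume 1 K =
      ∫ ω, sSup ((fun y => inner ℝ (Z ω) y) '' (Real.sqrt (2 * Real.pi) • K)) ∂P := by
  obtain ⟨R, hR⟩ := hbdd.exists_norm_le
  -- The dilation by √(2π) leaves the supremum as a factor, matching the σ of the slope computation.
  have hscale : ∀ z : EuclideanSpace ℝ (Fin n),
      sSup ((fun y => inner ℝ z y) '' (Real.sqrt (2 * Real.pi) • K)) =
        Real.sqrt (2 * Real.pi) * supportFunction K z := fun z => by
    rw [supportFunction, ← smul_eq_mul (Real.sqrt (2 * Real.pi)), ← Real.sSup_smul_of_nonneg (Real.sqrt_nonneg _),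
      ← Set.image_smul, ← Set.image_smul, Set.image_image, Set.image_image]
    simp only [inner_smul_right, smul_eq_mul]
  have hint : Integrable (supportFunction K) (stdGaussian (EuclideanSpace ℝ (Fin n))) :=
    integrable_supportFunction hne hR (integrable_exp_mul_norm_stdGaussian _)
  have hp := isSteinerPolynomial_steinerPolynomial hconv hbdd hne
  simp only [hscale]
  refine ⟨fun t ht => ⟨(hp.2 t ht).1, ?_⟩, ?_, ?_⟩
  · rw [(hp.2 t ht).2, Polynomial.eval_eq_sum_range' (Nat.lt_succ_of_le hp.1)]
    refine Finset.sum_congr rfl fun i hi => ?_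
    have : (n.choose i : ℝ) ≠ 0 := by
      exact_mod_cast (Nat.choose_pos (Nat.lt_succ_iff.1 (Finset.mem_range.1 hi))).ne'
    rw [quermassintegral, mul_div_cancel₀ _ this]
  · rw [← hZ.map_eq] at hint
    exact (hint.comp_aemeasurable hZ.aemeasurable).const_mul _
  · rw [integral_const_mul, intrinsicVolume_one_eq_integral_supportFunction hconv hbdd hne,
      ← hZ.map_eq, integral_map hZ.aemeasurable
        (continuous_supportFunction hne hR).aestronglyMeasurable]
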